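/- Let $X$ be a real Banach space, let $\varphi\in X^*\setminus\{0\}$, and let $\psi:X\to\mathbb{R}$ be Lipschitz with constant $\|\varphi\|_{X^*}$, i.e. $|\psi(x)-\psi(y)|\le\|\varphi\|_{X^*}\|x-y\|$ for all $x,y\in X$. Let $[a,b]$ (with $a\le b$) be a compact real interval, let $\gamma:[a,b]\to[-1,1]$ be a continuous function such that the set $\gamma^{-1}(\{-1,1\})$ has empty interior, and let $c\in\mathbb{R}$. Assume that either (i) $\gamma$ is convex and $\gamma(a)\psi(x)+ca\neq\gamma(b)\psi(x)+cb$ for all $x\in X$ with $\psi(x)>0$; or (ii) $\gamma$ is concave and $\gamma(a)\psi(x)+ca\neq\gamma(b)\psi(x)+cb$ for all $x\in X$ with $\psi(x)<0$. Then, as an equality in $[-\infty,+\infty]$ and with the convention $\sup\emptyset=-\infty$, $$\sup_{\lambda\in\gamma^{-1}(\{-1,1\})}\ \inf_{x\in X}\bigl(\varphi(x)+\gamma(\lambda)\psi(x)+c\lambda\bigr)=\inf_{x\in X}\ \sup_{\lambda\in[a,b]}\bigl(\varphi(x)+\gamma(\lambda)\psi(x)+c\lambda\bigr).$$ -/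

import Mathlib

open Set

/-!
For `|k| < 1` the functional `φ + k • ψ` decreases at a uniform rate in some direction, so its
infimum is `-∞` and its sublevel sets are connected. Hence the parameters with `|γ l| < 1`, which
are dense, do not contribute to the left-hand supremum, and what remains is a minimax equality for
`f x l = φ x + γ l * ψ x + c * l` on `X × [a, b]`.

If `sup inf < r = inf sup`, the open set `{f < r} ⊆ X × [a, b]` projects onto `[a, b]` and has
connected fibres over a dense set of parameters, so it is connected. When the maximizers of each
`f x` form an interval, a point `(x, l)` of this set has `l` either above or below all of them. Both
cases are open conditions, and both occur, at `l = b` and at `l = a`: a contradiction. Convexity or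
concavity of `γ`, with the endpoint condition, makes the maximizers an interval.
-/

section Topology

variable {X Y Z : Type*} [TopologicalSpace X] [TopologicalSpace Y] [TopologicalSpace Z]

theorem isPreconnected_of_isOpen_of_dense_fibers [PreconnectedSpace Y] {W : Set (X × Y)}
    (hW : IsOpen W) (hproj : Prod.snd '' W = univ)
    (hdense : Dense {y | IsPreconnected {x | (x, y) ∈ W}}) : IsPreconnected W := by
  intro U V hU hV hWUV hWU hWV
  have hA : IsOpen (Prod.snd '' (W ∩ U)) := isOpenMap_snd _ (hW.inter hU)
  have hB : IsOpen (Prod.snd '' (W ∩ V)) := isOpenMap_snd _ (hW.inter hV)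
  have hAB : Prod.snd '' (W ∩ U) ∪ Prod.snd '' (W ∩ V) = univ := by
    rw [← image_union, ← inter_union_distrib_left, inter_eq_left.2 hWUV, hproj]
  obtain ⟨_, ⟨⟨⟨x₁, _⟩, ⟨hx₁, hx₁U⟩, rfl⟩, ⟨x₂, y⟩, ⟨hx₂, hx₂V⟩, rfl⟩, hy⟩ :=
    hdense.inter_open_nonempty _ (hA.inter hB)
      (nonempty_inter hA hB hAB (hWU.image _) (hWV.image _))
  have hfiber : Continuous fun x : X => (x, y) := by fun_prop
  obtain ⟨x, hx, hxUV⟩ := hy _ _ (hU.preimage hfiber) (hV.preimage hfiber)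
    (fun x hx => hWUV hx) ⟨x₁, hx₁, hx₁U⟩ ⟨x₂, hx₂, hx₂V⟩
  exact ⟨(x, y), hx, hxUV⟩

theorem isOpen_setOf_forall_mem_imp_mem [CompactSpace Y] {F : Set (X × Y)} (hF : IsClosed F)
    {R : Set (Y × Z)} (hR : IsOpen R) :
    IsOpen {p : X × Z | ∀ y, (p.1, y) ∈ F → (y, p.2) ∈ R} := by
  have hbad : IsClosed {q : (X × Z) × Y | (q.1.1, q.2) ∈ F ∧ (q.2, q.1.2) ∈ Rᶜ} :=
    (hF.preimage (by fun_prop)).inter (hR.isClosed_compl.preimage (by fun_prop))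
  convert (isClosedMap_fst_of_compactSpace _ hbad).isOpen_compl using 1
  ext p
  simp

theorem dense_preimage_val_compl_of_interior_inter_eq_empty {s t : Set X}
    (ht : t ⊆ closure (interior t)) (hts : interior (t ∩ s) = ∅) :
    Dense ((↑) ⁻¹' sᶜ : Set t) := by
  rw [Subtype.dense_iff, Subtype.image_preimage_coe]
  refine ht.trans (closure_minimal (fun x hx => ?_) isClosed_closure)
  by_contra hxcl
  have hsub : interior t ∩ (closure (t ∩ sᶜ))ᶜ ⊆ t ∩ s := fun y hy =>
    ⟨interior_subset hy.1, by_contra fun hys => hy.2 (subset_closure ⟨interior_subset hy.1, hys⟩)⟩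
  exact hts.le (interior_maximal hsub (isOpen_interior.inter isClosed_closure.isOpen_compl)
    ⟨hx, hxcl⟩)

theorem dense_preimage_val_compl_of_interior_Icc_inter_eq_empty {J : Type*} [LinearOrder J]
    [TopologicalSpace J] [OrderTopology J] [DenselyOrdered J] {a b : J} (hab : a ≠ b) {s : Set J}
    (hs : interior (Icc a b ∩ s) = ∅) : Dense ((↑) ⁻¹' sᶜ : Set (Icc a b)) := by
  refine dense_preimage_val_compl_of_interior_inter_eq_empty ?_ hs
  calc Icc a b = closure (Ioo a b) := (closure_Ioo hab).symm
    _ ⊆ closure (interior (Icc a b)) :=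
      closure_mono (interior_maximal Ioo_subset_Icc_self isOpen_Ioo)

end Topology

section Minimax

variable {X I : Type*} [TopologicalSpace X] [LinearOrder I] [BoundedOrder I] [TopologicalSpace I]
  [OrderClosedTopology I] [CompactSpace I]

/-- An intermediate value theorem: `M` is the graph of an interval-valued map. -/
theorem inter_nonempty_of_isPreconnected_of_ordConnected_fibers {W M : Set (X × I)}
    (hW : IsPreconnected W) (hbot : ∃ x, (x, ⊥) ∈ W) (htop : ∃ x, (x, ⊤) ∈ W) (hM : IsClosed M)
    (hne : ∀ x, ∃ m, (x, m) ∈ M) (hord : ∀ x, {m | (x, m) ∈ M}.OrdConnected) :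
    (W ∩ M).Nonempty := by
  by_contra hWM
  have hdisj : ∀ p ∈ W, p ∉ M := fun p hpW hpM => hWM ⟨p, hpW, hpM⟩
  let above : Set (X × I) := {p | ∀ m, (p.1, m) ∈ M → m < p.2}
  let below : Set (X × I) := {p | ∀ m, (p.1, m) ∈ M → p.2 < m}
  have habove : IsOpen above :=
    isOpen_setOf_forall_mem_imp_mem hM (isOpen_lt continuous_fst continuous_snd)
  have hbelow : IsOpen below :=
    isOpen_setOf_forall_mem_imp_mem hM (isOpen_lt continuous_snd continuous_fst)
  have hcover : W ⊆ above ∪ below := by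
    rintro ⟨x, l⟩ hxl
    by_contra hcon
    simp only [above, below, mem_union, mem_ofPred_eq, not_or, not_forall, not_lt] at hcon
    obtain ⟨⟨n, hn, hln⟩, m, hm, hml⟩ := hcon
    exact hdisj _ hxl ((hord x).out hm hn ⟨hml, hln⟩)
  obtain ⟨x₀, hx₀⟩ := hbot
  obtain ⟨x₁, hx₁⟩ := htop
  obtain ⟨⟨x, l⟩, -, hl_above, hl_below⟩ := hW above below habove hbelow hcover
    ⟨(x₁, ⊤), hx₁, fun m hm => lt_top_iff_ne_top.2 fun h => hdisj _ hx₁ (h ▸ hm)⟩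
    ⟨(x₀, ⊥), hx₀, fun m hm => bot_lt_iff_ne_bot.2 fun h => hdisj _ hx₀ (h ▸ hm)⟩
  obtain ⟨m, hm⟩ := hne x
  exact lt_asymm (hl_above m hm) (hl_below m hm)

theorem iSup_iInf_eq_iInf_iSup_of_ordConnected_maximizers [PreconnectedSpace I] {α : Type*}
    [CompleteLinearOrder α] [TopologicalSpace α] [OrderClosedTopology α]
    {f : X → I → α} (hf : Continuous fun p : X × I => f p.1 p.2)
    (hconn : Dense {l | ∀ r, IsPreconnected {x | f x l < r}})
    (hmax : ∀ x, {m | ∀ k, f x k ≤ f x m}.OrdConnected) :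
    ⨆ l, ⨅ x, f x l = ⨅ x, ⨆ l, f x l := by
  refine (iSup_iInf_le_iInf_iSup fun l x => f x l).antisymm (not_lt.1 fun hlt => ?_)
  set r := ⨅ x, ⨆ l, f x l
  have hlow (l : I) : ∃ x, f x l < r :=
    iInf_lt_iff.1 ((le_iSup (fun l => ⨅ x, f x l) l).trans_lt hlt)
  have hproj : Prod.snd '' {p : X × I | f p.1 p.2 < r} = univ :=
    eq_univ_of_forall fun l => (hlow l).elim fun x hx => ⟨(x, l), hx, rfl⟩
  have hpre : IsPreconnected {p : X × I | f p.1 p.2 < r} :=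
    isPreconnected_of_isOpen_of_dense_fibers (isOpen_lt hf continuous_const) hproj
      (hconn.mono fun l (hl : ∀ r, IsPreconnected {x | f x l < r}) => hl r)
  have hclosed : IsClosed {p : X × I | ∀ k, f p.1 k ≤ f p.1 p.2} := by
    simp only [ofPred_forall]
    exact isClosed_iInter fun k => isClosed_le
      (hf.comp (by fun_prop : Continuous fun p : X × I => (p.1, k))) hf
  have hexists (x : X) : ∃ m, ∀ k, f x k ≤ f x m := by
    have hfx : Continuous (f x) := hf.comp (by fun_prop : Continuous fun l : I => (x, l))
    obtain ⟨m, -, hm⟩ := isCompact_univ.exists_isMaxOn univ_nonempty hfx.continuousOn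
    exact ⟨m, fun k => hm (mem_univ k)⟩
  obtain ⟨⟨x, m⟩, hlt_r, hm⟩ := inter_nonempty_of_isPreconnected_of_ordConnected_fibers
    hpre (hlow ⊥) (hlow ⊤) hclosed hexists hmax
  exact (show f x m < r from hlt_r).not_ge ((iInf_le _ x).trans (iSup_le hm))

end Minimax

section Descent

variable {X : Type*} [AddCommGroup X] [Module ℝ X]

/-- `u` is a direction of uniform descent for `g`: from every starting point, `g` decreases along
`u` at average rate at least `1`. Any positive rate is brought to `1` by rescaling `u`. -/
def IsUniformDescentDirection (g : X → ℝ) (u : X) : Prop :=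
  ∀ (x : X) (t : ℝ), 0 ≤ t → g (x + t • u) ≤ g x - t

namespace IsUniformDescentDirection

variable {g : X → ℝ} {u : X}

theorem iInf_coe_eq_bot (hu : IsUniformDescentDirection g u) : ⨅ x, (g x : EReal) = ⊥ := by
  refine (EReal.eq_bot_iff_forall_lt _).2 fun r => ?_
  refine (iInf_le _ (0 + (|g 0 - r| + 1) • u)).trans_lt (EReal.coe_lt_coe_iff.2 ?_)
  linarith [hu 0 (|g 0 - r| + 1) (by positivity), le_abs_self (g 0 - r)]

variable [TopologicalSpace X] [ContinuousAdd X] [ContinuousSMul ℝ X]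

theorem isPreconnected_setOf_le (hu : IsUniformDescentDirection g u) (hg : Continuous g) (r : ℝ) :
    IsPreconnected {x | g x ≤ r} := by
  -- Moving along `u` by the excess of `g` over `r` retracts `X` onto the sublevel set.
  have hrange : {x | g x ≤ r} = range fun x => x + max 0 (g x - r) • u := by
    refine Subset.antisymm (fun x hx => ⟨x, ?_⟩) (range_subset_iff.2 fun x => ?_)
    · simp [max_eq_left (sub_nonpos.2 (show g x ≤ r from hx))]
    · exact (hu x _ (le_max_left _ _)).trans (by linarith [le_max_right 0 (g x - r)])
  rw [hrange]
  exact isPreconnected_range (by fun_prop)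

theorem isPreconnected_setOf_lt (hu : IsUniformDescentDirection g u) (hg : Continuous g) (r : ℝ) :
    IsPreconnected {x | g x < r} :=
  isPreconnected_of_forall_pair fun x hx y hy =>
    ⟨{z | g z ≤ max (g x) (g y)}, fun z (hz : g z ≤ _) => hz.trans_lt (max_lt hx hy),
      le_max_left (g x) (g y), le_max_right (g x) (g y), hu.isPreconnected_setOf_le hg _⟩

theorem isPreconnected_setOf_coe_lt (hu : IsUniformDescentDirection g u) (hg : Continuous g)
    (r : EReal) : IsPreconnected {x | (g x : EReal) < r} := by
  induction r with
  | bot => simp [isPreconnected_empty]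
  | coe r => simpa only [EReal.coe_lt_coe_iff] using hu.isPreconnected_setOf_lt hg r
  | top => simp [isPreconnected_univ]

end IsUniformDescentDirection

end Descent

section Perturbation

theorem abs_lt_one_of_mem_Icc_of_notMem {k : ℝ} (hk : k ∈ Icc (-1) 1)
    (hk' : k ∉ ({-1, 1} : Set ℝ)) : |k| < 1 :=
  (abs_le.2 hk).lt_of_ne fun h => hk' (eq_or_eq_neg_of_abs_eq h).symm

variable {X : Type*} [SeminormedAddCommGroup X] [NormedSpace ℝ X]

theorem exists_isUniformDescentDirection_add {φ : X →L[ℝ] ℝ} {h : X → ℝ} {K : NNReal}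
    (hh : LipschitzWith K h) (hK : K < ‖φ‖₊) :
    ∃ u, IsUniformDescentDirection (fun x => φ x + h x) u := by
  obtain ⟨v, hv⟩ : ∃ v, φ v + K * ‖v‖ < 0 := by
    obtain ⟨v, hv⟩ : ∃ v, K * ‖v‖ < |φ v| := φ.exists_mul_lt_of_lt_opNorm K.2 hK
    rcases abs_cases (φ v) with ⟨habs, -⟩ | ⟨habs, -⟩
    · exact ⟨-v, by rw [map_neg, norm_neg]; linarith⟩
    · exact ⟨v, by linarith⟩
  set δ := -(φ v + K * ‖v‖)
  have hδ : 0 < δ := neg_pos.2 hv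
  refine ⟨δ⁻¹ • v, fun x t ht => ?_⟩
  have hs : 0 ≤ t * δ⁻¹ := by positivity
  have hlip : h (x + (t * δ⁻¹) • v) - h x ≤ K * (t * δ⁻¹ * ‖v‖) := by
    have := hh.dist_le_mul (x + (t * δ⁻¹) • v) x
    rw [dist_self_add_left, norm_smul, Real.norm_of_nonneg hs] at this
    exact (le_abs_self _).trans this
  calc φ (x + t • δ⁻¹ • v) + h (x + t • δ⁻¹ • v)
      ≤ φ x + t * δ⁻¹ * φ v + (h x + K * (t * δ⁻¹ * ‖v‖)) := by
        rw [smul_smul, map_add, map_smul, smul_eq_mul]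
        linarith
    _ = φ x + h x - t * (δ⁻¹ * δ) := by ring
    _ = φ x + h x - t := by rw [inv_mul_cancel₀ hδ.ne', mul_one]

theorem exists_isUniformDescentDirection_add_mul_add_const {φ : X →L[ℝ] ℝ} (hφ : φ ≠ 0)
    {ψ : X → ℝ} (hψ : LipschitzWith ‖φ‖₊ ψ) {k : ℝ} (hk : |k| < 1) (d : ℝ) :
    ∃ u, IsUniformDescentDirection (fun x => φ x + k * ψ x + d) u := by
  have hpos : 0 < ‖φ‖₊ := by
    obtain ⟨v, hv⟩ : ∃ v, φ v ≠ 0 := DFunLike.ne_iff.1 hφ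
    refine pos_of_mul_pos_left (b := ‖v‖₊) ?_ zero_le
    exact (nnnorm_pos.2 hv).trans_le (φ.le_opNNNorm v)
  have hlip : LipschitzWith (‖k‖₊ * ‖φ‖₊) fun x => k * ψ x + d :=
    LipschitzWith.of_dist_le_mul fun x y => by
      simpa [mul_assoc] using (lipschitzWith_smul k).comp hψ |>.dist_le_mul x y
  simpa only [add_assoc] using
    exists_isUniformDescentDirection_add hlip (mul_lt_of_lt_one_left hpos hk)

end Perturbation

section Maximizers

variable {𝕜 E β : Type*} [Field 𝕜] [LinearOrder 𝕜]

theorem convex_setOf_isMaxOn_of_concaveOn [AddCommMonoid E] [SMul 𝕜 E] [AddCommMonoid β]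
    [PartialOrder β] [IsOrderedAddMonoid β] [Module 𝕜 β] [PosSMulMono 𝕜 β] {s : Set E} {g : E → β}
    (hg : ConcaveOn 𝕜 s g) : Convex 𝕜 {m ∈ s | IsMaxOn g s m} := by
  rintro m ⟨hm, hgm⟩ n ⟨hn, hgn⟩ p q hp hq hpq
  have hmem := hg.convex_ge (g m) ⟨hm, le_rfl⟩ ⟨hn, hgn hm⟩ hp hq hpq
  exact ⟨hmem.1, fun k hk => (hgm hk).trans hmem.2⟩

theorem subsingleton_setOf_isMaxOn_of_convexOn_Icc [IsStrictOrderedRing 𝕜] [AddCommMonoid β]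
    [LinearOrder β] [IsOrderedCancelAddMonoid β] [Module 𝕜 β] [PosSMulStrictMono 𝕜 β] {a b : 𝕜}
    {g : 𝕜 → β} (hg : ConvexOn 𝕜 (Icc a b) g) (hne : g a ≠ g b) :
    {m ∈ Icc a b | IsMaxOn g (Icc a b) m}.Subsingleton := by
  rintro m ⟨hm, hgm⟩ n ⟨hn, hgn⟩
  by_contra hmn
  wlog hlt : m < n generalizing m n
  · exact this hn hgn hm hgm (Ne.symm hmn) ((Ne.lt_or_gt hmn).resolve_left hlt)
  have ha : a ∈ Icc a b := left_mem_Icc.2 (hm.1.trans hm.2)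
  have hb : b ∈ Icc a b := right_mem_Icc.2 (hm.1.trans hm.2)
  have hma : g m ≤ g a := by
    rcases hm.1.eq_or_lt with rfl | ham
    · exact le_rfl
    · have hmb : m < b := hlt.trans_le hn.2
      have hmem : m ∈ openSegment 𝕜 a b := openSegment_eq_Ioo (ham.trans hmb) ▸ ⟨ham, hmb⟩
      exact not_lt.1 fun h => (hg.lt_right_of_left_lt ha hb hmem h).not_ge (hgm hb)
  have hnb : g n ≤ g b := by
    rcases hn.2.eq_or_lt with rfl | hnb
    · exact le_rfl
    · have han : a < n := hm.1.trans_lt hlt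
      have hmem : n ∈ openSegment 𝕜 a b := openSegment_eq_Ioo (han.trans hnb) ▸ ⟨han, hnb⟩
      exact not_lt.1 fun h => (hg.lt_left_of_right_lt ha hb hmem h).not_ge (hgn ha)
  exact hne (((hgn ha).trans hnb).antisymm ((hgm hb).trans hma))

theorem ordConnected_setOf_isMaxOn_mul_add_of_convexOn [IsStrictOrderedRing 𝕜]
    {a b c t : 𝕜} {γ : 𝕜 → 𝕜} (hγ : ConvexOn 𝕜 (Icc a b) γ)
    (hne : 0 < t → γ a * t + c * a ≠ γ b * t + c * b) :
    {m ∈ Icc a b | IsMaxOn (fun l => γ l * t + c * l) (Icc a b) m}.OrdConnected := by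
  let linear := LinearMap.mulLeft 𝕜 c
  rcases lt_or_ge 0 t with ht | ht
  · have hconv : ConvexOn 𝕜 (Icc a b) fun l => γ l * t + c * l :=
      ((hγ.smul ht.le).add (linear.convexOn (convex_Icc a b))).congr fun l _ => by
        simp [linear, mul_comm]
    exact (subsingleton_setOf_isMaxOn_of_convexOn_Icc hconv (hne ht)).convex.ordConnected
  · have hconc : ConcaveOn 𝕜 (Icc a b) fun l => γ l * t + c * l :=
      ((hγ.smul (neg_nonneg.2 ht)).neg.add (linear.concaveOn (convex_Icc a b))).congr fun l _ => by
        simp [linear, mul_comm]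
    exact (convex_setOf_isMaxOn_of_concaveOn hconc).ordConnected

theorem ordConnected_setOf_isMaxOn_mul_add_of_concaveOn [IsStrictOrderedRing 𝕜]
    {a b c t : 𝕜} {γ : 𝕜 → 𝕜} (hγ : ConcaveOn 𝕜 (Icc a b) γ)
    (hne : t < 0 → γ a * t + c * a ≠ γ b * t + c * b) :
    {m ∈ Icc a b | IsMaxOn (fun l => γ l * t + c * l) (Icc a b) m}.OrdConnected := by
  simpa using ordConnected_setOf_isMaxOn_mul_add_of_convexOn hγ.neg (t := -t) (by simpa using hne)

end Maximizers

section Main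

variable {X J : Type*} [SeminormedAddCommGroup X] [NormedSpace ℝ X]

theorem iSup_inter_preimage_iInf_eq_iSup_iInf {φ : X →L[ℝ] ℝ} (hφ : φ ≠ 0) {ψ : X → ℝ}
    (hψ : LipschitzWith ‖φ‖₊ ψ) {s : Set J} {γ : J → ℝ} (hγ : MapsTo γ s (Icc (-1) 1))
    (h : J → ℝ) :
    ⨆ l ∈ s ∩ γ ⁻¹' {-1, 1}, ⨅ x, ((φ x + γ l * ψ x + h l : ℝ) : EReal) =
      ⨆ l ∈ s, ⨅ x, ((φ x + γ l * ψ x + h l : ℝ) : EReal) := by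
  refine (biSup_mono fun l hl => hl.1).antisymm (iSup₂_le fun l hl => ?_)
  by_cases hl' : l ∈ γ ⁻¹' {-1, 1}
  · exact le_iSup₂_of_le l ⟨hl, hl'⟩ le_rfl
  · obtain ⟨u, hu⟩ := exists_isUniformDescentDirection_add_mul_add_const hφ hψ
      (abs_lt_one_of_mem_Icc_of_notMem (hγ hl) hl') (h l)
    exact hu.iInf_coe_eq_bot.trans_le bot_le

variable [ConditionallyCompleteLinearOrder J] [DenselyOrdered J] [TopologicalSpace J]
  [OrderTopology J]

theorem theorem5_general {φ : X →L[ℝ] ℝ} (hφ : φ ≠ 0) {ψ : X → ℝ} (hψ : LipschitzWith ‖φ‖₊ ψ)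
    {a b : J} {γ h : J → ℝ} (hγ : MapsTo γ (Icc a b) (Icc (-1) 1))
    (hγc : ContinuousOn γ (Icc a b)) (hhc : ContinuousOn h (Icc a b))
    (hint : interior (Icc a b ∩ γ ⁻¹' {-1, 1}) = ∅)
    (hmax : ∀ x, {m ∈ Icc a b | IsMaxOn (fun l => γ l * ψ x + h l) (Icc a b) m}.OrdConnected) :
    ⨆ l ∈ Icc a b ∩ γ ⁻¹' {-1, 1}, ⨅ x, ((φ x + γ l * ψ x + h l : ℝ) : EReal) =
      ⨅ x, ⨆ l ∈ Icc a b, ((φ x + γ l * ψ x + h l : ℝ) : EReal) := by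
  rw [iSup_inter_preimage_iInf_eq_iSup_iInf hφ hψ hγ h]
  rcases le_or_gt b a with hba | hab
  · rcases (subsingleton_Icc_of_ge hba).eq_empty_or_singleton with hs | ⟨l, hs⟩ <;> simp [hs]
  have : Fact (a ≤ b) := ⟨hab.le⟩
  have hγr : Continuous fun l : Icc a b => γ l := continuousOn_iff_continuous_domRestrict.1 hγc
  have hhr : Continuous fun l : Icc a b => h l := continuousOn_iff_continuous_domRestrict.1 hhc
  have hψc : Continuous ψ := hψ.continuous
  simp only [iSup_subtype']
  refine iSup_iInf_eq_iInf_iSup_of_ordConnected_maximizers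
    (f := fun x (l : Icc a b) => ((φ x + γ l * ψ x + h l : ℝ) : EReal)) ?_ ?_ fun x => ?_
  · have hγp : Continuous fun p : X × Icc a b => γ p.2 := hγr.comp continuous_snd
    have hhp : Continuous fun p : X × Icc a b => h p.2 := hhr.comp continuous_snd
    have hψp : Continuous fun p : X × Icc a b => ψ p.1 := hψc.comp continuous_fst
    exact continuous_coe_real_ereal.comp
      (((φ.continuous.comp continuous_fst).add (hγp.mul hψp)).add hhp)
  · refine (dense_preimage_val_compl_of_interior_Icc_inter_eq_empty hab.ne hint).mono
      fun l hl r => ?_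
    obtain ⟨u, hu⟩ := exists_isUniformDescentDirection_add_mul_add_const hφ hψ
      (abs_lt_one_of_mem_Icc_of_notMem (hγ l.2) hl) (h l)
    exact hu.isPreconnected_setOf_coe_lt (by fun_prop) r
  · have hpreimage := (hmax x).preimage_mono (Subtype.mono_coe (· ∈ Icc a b))
    refine (congrArg OrdConnected (Set.ext fun m => ?_)).mp hpreimage
    simp [-EReal.coe_add, -EReal.coe_mul, isMaxOn_iff, add_assoc, m.2.1, m.2.2]

end Main

theorem theorem5 {X : Type*} [NormedAddCommGroup X] [NormedSpace ℝ X] [CompleteSpace X]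
    (φ : X →L[ℝ] ℝ) (hφ : φ ≠ 0)
    (ψ : X → ℝ) (hψ : LipschitzWith ‖φ‖₊ ψ)
    (a b : ℝ) (hab : a ≤ b)
    (γ : ℝ → ℝ) (hγ : Set.MapsTo γ (Set.Icc a b) (Set.Icc (-1) 1))
    (hγc : ContinuousOn γ (Set.Icc a b))
    (hint : interior (Set.Icc a b ∩ γ ⁻¹' {-1, 1}) = ∅)
    (c : ℝ)
    (hconv :
      (ConvexOn ℝ (Set.Icc a b) γ ∧
        ∀ x : X, 0 < ψ x → γ a * ψ x + c * a ≠ γ b * ψ x + c * b) ∨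
      (ConcaveOn ℝ (Set.Icc a b) γ ∧
        ∀ x : X, ψ x < 0 → γ a * ψ x + c * a ≠ γ b * ψ x + c * b)) :
    (⨆ l ∈ Set.Icc a b ∩ γ ⁻¹' {-1, 1},
        ⨅ x : X, ((φ x + γ l * ψ x + c * l : ℝ) : EReal)) =
      ⨅ x : X, ⨆ l ∈ Set.Icc a b, ((φ x + γ l * ψ x + c * l : ℝ) : EReal) :=
  theorem5_general hφ hψ hγ hγc (by fun_prop) hint fun x => hconv.elim
    (fun h => ordConnected_setOf_isMaxOn_mul_add_of_convexOn h.1 (h.2 x))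
    (fun h => ordConnected_setOf_isMaxOn_mul_add_of_concaveOn h.1 (h.2 x))
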